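/- Baire space is $\mathbb{N}^{\mathbb{N}}$. A partial function $F:\subseteq\mathbb{N}^{\mathbb{N}}\to\mathbb{N}^{\mathbb{N}}$ is computable if there is a computable function $\varphi$ on finite words over $\mathbb{N}$, monotone for the prefix order, such that $F(p)$ is the limit of the words $\varphi(p(0)\dots p(k-1))$, $k\to\infty$, and $\mathrm{dom}(F)$ is the set of those $p$ for which this limit is infinite. A representation of a set $X$ is a surjective partial map $\delta_X:\subseteq\mathbb{N}^{\mathbb{N}}\to X$; if $\delta_X(p)=x$, then $p$ is called a name of $x$. A realizer of a partial multi-valued function $f:\subseteq X\rightrightarrows Y$ between represented spaces is a partial function $F:\subseteq\mathbb{N}^{\mathbb{N}}\to\mathbb{N}^{\mathbb{N}}$ such that $\delta_Y F(p)\in f(\delta_X(p))$ for all $p$ with $\delta_X(p)\in\mathrm{dom}(f)$. One writes $f\le_{\mathrm W} g$ if there are computable $H,K:\subseteq\mathbb{N}^{\mathbb{N}}\to\mathbb{N}^{\mathbb{N}}$ such that for every realizer $G$ of $g$ the function $p\mapsto H\langle p,GK(p)\rangle$ is a realizer of $f$, where $\langle p,q\rangle(2n)=p(n)$ and $\langle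 p,q\rangle(2n+1)=q(n)$; and $f\equiv_{\mathrm W} g$ ($f$ and $g$ are Weihrauch equivalent) if $f\le_{\mathrm W} g$ and $g\le_{\mathrm W} f$. A non-empty computable metric space is a metric space $(X,d)$ together with a dense sequence $\alpha:\mathbb{N}\to X$ such that $(d(\alpha(i),\alpha(j)))_{i,j\in\mathbb{N}}$ is a computable double sequence of real numbers. The rational open balls are the sets $B_{\langle i,n\rangle}=\{x\in X:d(\alpha(i),x)<r_n\}$, where $(r_n)_{n\in\mathbb{N}}$ is a standard numbering of $\mathbb{Q}$ (so $B_{\langle i,n\rangle}=\emptyset$ if $r_n\le 0$). Let $\mathcal{A}_-(X)$ be the set of closed subsets of $X$, represented by negative information: $p$ is a name of $A$ iff $X\setminus A=\bigcup_{i\in\mathbb{N}}B_{p(i)}$. The set $\mathcal{A}_-(X)^{\mathbb{N}}$ has the induced representation ($p$ is a name of $(A_i)_{i\in\mathbb{N}}$ iff $k\mapsto p(\langle i,k\rangle)$ is a name of $A_i$ for every $i$). The set $\mathcal{A}_-(\mathbb{N})$ of subsets of $\mathbb{N}$ is represented as follows: $p$ is a name of $A$ iff $\mathbb{N}\setminus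 A=\{n:n+1\in\mathrm{range}(p)\}$. The set $\mathbb{N}$ is represented by $p\mapsto p(0)$. Let $\mathsf{C}_{\mathbb{N}}:\subseteq\mathcal{A}_-(\mathbb{N})\rightrightarrows\mathbb{N}$, $A\mapsto A$, with $\mathrm{dom}(\mathsf{C}_{\mathbb{N}})=\{A:A\neq\emptyset\}$ (discrete choice). For a complete computable metric space $X$ let $$\mathsf{BCT}_X:\subseteq\mathcal{A}_-(X)^{\mathbb{N}}\rightrightarrows\mathbb{N},\quad (A_i)_{i\in\mathbb{N}}\mapsto\{n\in\mathbb{N}:A_n\text{ has non-empty interior}\},$$ with $\mathrm{dom}(\mathsf{BCT}_X)=\{(A_i)_{i\in\mathbb{N}}:\bigcup_{i\in\mathbb{N}}A_i=X\}$. **Theorem (Baire Category Theorem).** Let $X$ be a non-empty complete computable metric space. Then $\mathsf{BCT}_X\equiv_{\mathrm W}\mathsf{C}_{\mathbb{N}}$. -/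

import Mathlib

namespace CompAnalysis

/-- Baire space `ℕ^ℕ`. -/
abbrev Baire : Type := ℕ → ℕ

/-- The finite word `p(0) p(1) … p(k-1)`. -/
def initSeg (p : Baire) (k : ℕ) : List ℕ := (List.range k).map p

/-- Computability of a partial function `F : ⊆ ℕ^ℕ → ℕ^ℕ` (in the sense of Type-2 computability):
there is a computable function `φ` on finite words, monotone for the prefix order, such that, when
`φ` is applied to longer and longer initial segments of `p`, the words it produces approximate the
infinite output `F p`. The domain of `F` is exactly the set of those `p` for which the output is
infinite. -/
def ComputableFun (F : Baire →. Baire) : Prop :=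
  ∃ φ : List ℕ → List ℕ, Computable φ ∧
    (∀ σ τ : List ℕ, σ <+: τ → φ σ <+: φ τ) ∧
    ∀ p q : Baire, q ∈ F p ↔ ∀ n : ℕ, ∃ k : ℕ, (φ (initSeg p k))[n]? = some (q n)

/-- The standard pairing on Baire space: `⟨p, q⟩(2n) = p(n)` and `⟨p, q⟩(2n+1) = q(n)`. -/
def pairing (p q : Baire) : Baire := fun n => if n % 2 = 0 then p (n / 2) else q (n / 2)

/-- A representation of `X`: a surjective partial map `δ : ⊆ ℕ^ℕ → X`. -/
structure Representation (X : Type*) where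
  /-- the partial map -/
  map : Baire →. X
  /-- every point has a name -/
  surj : ∀ x : X, ∃ p : Baire, x ∈ map p

/-- A partial multi-valued function `f : ⊆ X ⇉ Y`, given by its domain and its sets of values
(values outside of the domain are irrelevant). -/
structure MultiFun (X Y : Type*) where
  /-- the domain `dom(f)` -/
  dom : Set X
  /-- the set `f(x)` of possible results -/
  val : X → Set Y

/-- `F ⊢ f`: the partial function `F` on Baire space is a realizer of `f` with respect to the
representations `δX`, `δY`, i.e. `δY (F p) ∈ f (δX p)` for all `p ∈ dom(f ∘ δX)`. -/
def IsRealizer {X Y : Type*} (δX : Representation X) (δY : Representation Y)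
    (f : MultiFun X Y) (F : Baire →. Baire) : Prop :=
  ∀ (p : Baire) (x : X), x ∈ δX.map p → x ∈ f.dom →
    ∃ q : Baire, q ∈ F p ∧ ∃ y : Y, y ∈ δY.map q ∧ y ∈ f.val x

/-- The partial function `H ∘ ⟨id, G ∘ K⟩`. -/
def translate (H K G : Baire →. Baire) : Baire →. Baire := fun p =>
  (K p).bind fun r => (G r).bind fun q => H (pairing p q)

/-- Weihrauch reducibility for sets of partial functions on Baire space. -/
def SetWeihrauchLE (𝓕 𝓖 : Set (Baire →. Baire)) : Prop :=
  ∃ H K : Baire →. Baire, ComputableFun H ∧ ComputableFun K ∧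
    ∀ G ∈ 𝓖, ∃ F ∈ 𝓕, F = translate H K G

/-- Weihrauch reducibility `f ≤_W g` for multi-valued functions on represented spaces. -/
def WeihrauchLE {X Y Z W : Type*}
    (δX : Representation X) (δY : Representation Y) (f : MultiFun X Y)
    (δZ : Representation Z) (δW : Representation W) (g : MultiFun Z W) : Prop :=
  SetWeihrauchLE {F | IsRealizer δX δY f F} {G | IsRealizer δZ δW g G}

/-- Weihrauch equivalence `f ≡_W g` for multi-valued functions on represented spaces. -/
def WeihrauchEquiv {X Y Z W : Type*}
    (δX : Representation X) (δY : Representation Y) (f : MultiFun X Y)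
    (δZ : Representation Z) (δW : Representation W) (g : MultiFun Z W) : Prop :=
  WeihrauchLE δX δY f δZ δW g ∧ WeihrauchLE δZ δW g δX δY f

/-- The standard representation of `ℕ`: `p` is a name of `p(0)`. -/
def natRep : Representation ℕ where
  map := fun p => Part.some (p 0)
  surj := fun n => ⟨fun _ => n, Part.mem_some n⟩

/-- The representation of `X^ℕ` induced by one of `X`: `p = ⟨p₀, p₁, …⟩`, where
`p⟨i, k⟩ = pᵢ(k)`, is a name of `(xᵢ)` if every `pᵢ` is a name of `xᵢ`. -/
noncomputable def seqRep {X : Type*} (δ : Representation X) : Representation (ℕ → X) where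
  map := fun p =>
    ⟨∀ i : ℕ, (δ.map fun k => p (Nat.pair i k)).Dom,
      fun h i => (δ.map fun k => p (Nat.pair i k)).get (h i)⟩
  surj := by
    intro x
    choose p hp using fun i => δ.surj (x i)
    have h : ∀ i, x i ∈ δ.map fun k =>
        (fun m : ℕ => p m.unpair.1 m.unpair.2) (Nat.pair i k) := by
      intro i
      simpa using hp i
    exact ⟨fun m => p m.unpair.1 m.unpair.2, fun i => (h i).1, funext fun i => (h i).2⟩

/-- The representation of the (closed) subsets of `ℕ` by negative information: `p` is a name of
`A` iff `ℕ \ A = {n | n + 1 ∈ range p}`. -/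
def natNegRep : Representation (Set ℕ) where
  map := fun p => Part.some {n : ℕ | n + 1 ∈ Set.range p}ᶜ
  surj := by
    classical
    intro A
    refine ⟨fun n => if n ∈ A then 0 else n + 1, Part.mem_some_iff.2 ?_⟩
    ext n
    simp only [Set.mem_compl_iff, Set.mem_ofPred_eq, Set.mem_range, not_exists]
    constructor
    · intro hn m
      by_cases hm : m ∈ A
      · simp [hm]
      · simp only [hm, if_false]
        intro h
        obtain rfl : m = n := by omega
        exact hm hn
    · intro h
      by_contra hn
      exact h n (by simp [hn])

/-- Discrete choice `C_ℕ : ⊆ 𝒜₋(ℕ) ⇉ ℕ, A ↦ A`, defined for non-empty `A`. -/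
def discreteChoice : MultiFun (Set ℕ) ℕ where
  dom := {A | A.Nonempty}
  val := fun A => A

/-- The standard numbering `⟨a, ⟨b, c⟩⟩ ↦ (a - b) / (c + 1)` of the rational numbers. -/
def ratNum (n : ℕ) : ℚ :=
  ((n.unpair.1 : ℚ) - (n.unpair.2.unpair.1 : ℚ)) / ((n.unpair.2.unpair.2 : ℚ) + 1)

/-- A computable double sequence of real numbers: rational approximations of any precision
`2^{-k}` can be computed uniformly. -/
def ComputableRealDoubleSeq (x : ℕ → ℕ → ℝ) : Prop :=
  ∃ f : ℕ × ℕ × ℕ → ℕ, Computable f ∧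
    ∀ i j k : ℕ, |x i j - (ratNum (f (i, j, k)) : ℝ)| ≤ (1 / 2 : ℝ) ^ k

/-- The data making a metric space `X` a (non-empty) computable metric space: a dense sequence
whose mutual distances form a computable double sequence of reals. -/
structure ComputableMetric (X : Type*) [MetricSpace X] where
  /-- the dense sequence -/
  pt : ℕ → X
  dense : DenseRange pt
  computable_dist : ComputableRealDoubleSeq fun i j => dist (pt i) (pt j)

namespace ComputableMetric

variable {X : Type*} [MetricSpace X]

/-- The rational open ball with code `m = ⟨i, n⟩`: its centre is the `i`-th point of the dense
sequence, its radius the `n`-th rational number. It is empty if the radius is not positive. -/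
def ratBall (𝒳 : ComputableMetric X) (m : ℕ) : Set X :=
  Metric.ball (𝒳.pt m.unpair.1) (ratNum m.unpair.2 : ℝ)

/-- The closed set whose complement is the union of the balls enumerated by `p`. -/
def negSet (𝒳 : ComputableMetric X) (p : Baire) : TopologicalSpace.Closeds X where
  carrier := (⋃ i : ℕ, 𝒳.ratBall (p i))ᶜ
  isClosed' := (isOpen_iUnion fun _ => Metric.isOpen_ball).isClosed_compl

theorem exists_ratNum (q : ℚ) : ∃ n : ℕ, ratNum n = q := by
  refine ⟨Nat.pair q.num.toNat (Nat.pair (-q.num).toNat (q.den - 1)), ?_⟩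
  have h1 : ((q.num.toNat : ℚ) - ((-q.num).toNat : ℚ)) = q.num := by
    have : ((q.num.toNat : ℤ) - ((-q.num).toNat : ℤ)) = q.num := by omega
    exact_mod_cast this
  have h2 : (((q.den - 1 : ℕ) : ℚ) + 1) = q.den := by
    have : q.den - 1 + 1 = q.den := Nat.sub_add_cancel q.den_pos
    exact_mod_cast this
  simp only [ratNum, Nat.unpair_pair, h1, h2, Rat.num_div_den]

theorem exists_negSet_eq (𝒳 : ComputableMetric X) (A : TopologicalSpace.Closeds X) :
    ∃ p : Baire, 𝒳.negSet p = A := by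
  classical
  obtain ⟨z, hz⟩ := exists_ratNum 0
  have hz' : 𝒳.ratBall (Nat.pair 0 z) = ∅ := by simp [ratBall, hz]
  refine ⟨fun m => if 𝒳.ratBall m ⊆ (A : Set X)ᶜ then m else Nat.pair 0 z, ?_⟩
  apply SetLike.coe_injective
  change (⋃ i : ℕ, 𝒳.ratBall _)ᶜ = (A : Set X)
  rw [compl_eq_comm]
  apply Set.Subset.antisymm
  · intro x hx
    obtain ⟨ε, hε, hεA⟩ := Metric.isOpen_iff.1 A.isClosed.isOpen_compl x hx
    obtain ⟨q, hq0, hq1⟩ := exists_rat_btwn (half_pos hε)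
    obtain ⟨i, hi⟩ := 𝒳.dense.exists_dist_lt x hq0
    obtain ⟨n, hn⟩ := exists_ratNum q
    have hsub : 𝒳.ratBall (Nat.pair i n) ⊆ (A : Set X)ᶜ := by
      intro y hy
      apply hεA
      simp only [ratBall, Nat.unpair_pair, hn, Metric.mem_ball] at hy ⊢
      have := dist_triangle y (𝒳.pt i) x
      rw [dist_comm (𝒳.pt i) x] at this
      linarith
    refine Set.mem_iUnion.2 ⟨Nat.pair i n, ?_⟩
    rw [if_pos hsub]
    simpa [ratBall, hn] using hi
  · refine Set.iUnion_subset fun m => ?_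
    by_cases h : 𝒳.ratBall m ⊆ (A : Set X)ᶜ
    · rwa [if_pos h]
    · rw [if_neg h, hz']
      exact Set.empty_subset _

/-- The representation `ψ₋` of the closed subsets of `X` by negative information: `p` is a name
of `A` iff `X \ A` is the union of the rational open balls with codes `p(0), p(1), …`. -/
def negRep (𝒳 : ComputableMetric X) : Representation (TopologicalSpace.Closeds X) where
  map := fun p => Part.some (𝒳.negSet p)
  surj := fun A => (𝒳.exists_negSet_eq A).imp fun _ h => Part.mem_some_iff.2 h.symm

end ComputableMetric

/-- `BCT_X : ⊆ 𝒜₋(X)^ℕ ⇉ ℕ`, which maps a sequence of closed sets covering `X` to the indices `n`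
for which the `n`-th set has non-empty interior. -/
def baireCategory (X : Type*) [MetricSpace X] : MultiFun (ℕ → TopologicalSpace.Closeds X) ℕ where
  dom := {A | (⋃ i : ℕ, (A i : Set X)) = Set.univ}
  val := fun A => {n : ℕ | (interior (A n : Set X)).Nonempty}

end CompAnalysis

/-! A closed set has non-empty interior iff it contains a rational ball of positive radius. Given
negative information, containing a ball is refutable: it fails iff the ball meets an enumerated one,
and two open balls meet iff some dense point lies in both, which a search over approximate distances
detects (`exists_memTest_iff`). So the pairs ⟨n, m⟩ with ball `m` of positive radius inside the
`n`-th set are given by negative information. By Baire's theorem such a pair exists, and discrete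
choice finds one.

Conversely, a subset of ℕ is turned into closed sets equal to X, which become empty once their index
is removed (`mem_negSet_removeBall_iff`).

Both translations read one input value per output, because the output index can code all other
search parameters. `weihrauchLE_of_lookup` thus settles computability for both. -/

namespace CompAnalysis

/-! ### Functionals reading a single value of their input -/

/-- The functional whose `t`-th output is computed from `t` and the single input value `p (e t)`. -/
def lookup (e : ℕ → ℕ) (h : ℕ → ℕ → ℕ) (p : Baire) : Baire := fun t => h t (p (e t))

/-- The outputs of `lookup e h` that are determined by the finite word `w`. -/
def lookupWord (e : ℕ → ℕ) (h : ℕ → ℕ → ℕ) (w : List ℕ) : List ℕ :=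
  -- With `e t ≤ t + 1`, every query for `t < w.length - 1` falls inside `w`, so the default 0 is
  -- never used.
  (List.range (w.length - 1)).map fun t => h t (w.getD (e t) 0)

theorem computable_lookupWord {e : ℕ → ℕ} {h : ℕ → ℕ → ℕ} (he : Computable e)
    (hh : Computable₂ h) : Computable (lookupWord e h) := by
  have hrec : Computable fun w : List ℕ => Nat.rec (motive := fun _ => List ℕ) []
      (fun t acc => acc ++ [h t (w.getD (e t) 0)]) (w.length - 1) := by
    refine Computable.nat_rec
      (h := fun (w : List ℕ) (y : ℕ × List ℕ) => y.2 ++ [h y.1 (w.getD (e y.1) 0)])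
      ?_ (Computable.const []) ?_
    · exact (Primrec.nat_sub.comp Primrec.list_length (Primrec.const 1)).to_comp
    · have ht : Computable fun x : List ℕ × ℕ × List ℕ => x.2.1 :=
        Computable.fst.comp Computable.snd
      have hget : Computable fun x : List ℕ × ℕ × List ℕ => x.1.getD (e x.2.1) 0 :=
        (Primrec.list_getD 0).to_comp.comp Computable.fst (he.comp ht)
      exact Computable.list_concat.comp (Computable.snd.comp Computable.snd) (hh.comp ht hget)
  refine hrec.of_eq fun w => ?_
  unfold lookupWord
  induction w.length - 1 with
  | zero => rfl
  | succ n ih => rw [List.range_succ, List.map_append, ← ih]; rfl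

theorem lookupWord_mono {e : ℕ → ℕ} (h : ℕ → ℕ → ℕ) (hle : ∀ t, e t ≤ t + 1) {σ τ : List ℕ}
    (hστ : σ <+: τ) : lookupWord e h σ <+: lookupWord e h τ := by
  have hlen := hστ.length_le
  rw [List.prefix_iff_getElem?]
  intro i hi
  have hi' : i < σ.length - 1 := by simpa [lookupWord] using hi
  have hei : e i < σ.length := by have := hle i; omega
  have hget : τ[e i]? = σ[e i]? := by
    rw [List.getElem?_eq_getElem hei]; exact List.prefix_iff_getElem?.1 hστ _ hei
  simp [lookupWord, List.getElem?_range (show i < τ.length - 1 by omega), List.getD, hget]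

theorem lookupWord_initSeg {e : ℕ → ℕ} (h : ℕ → ℕ → ℕ) (hle : ∀ t, e t ≤ t + 1) (p : Baire)
    {k n : ℕ} (hn : n < k - 1) : (lookupWord e h (initSeg p k))[n]? = some (lookup e h p n) := by
  have hen : e n < k := by have := hle n; omega
  simp [lookupWord, lookup, initSeg, List.getElem?_range hn, List.getD, List.getElem?_range hen]

theorem computableFun_lookup {e : ℕ → ℕ} {h : ℕ → ℕ → ℕ} (he : Computable e)
    (hh : Computable₂ h) (hle : ∀ t, e t ≤ t + 1) :
    ComputableFun fun p => Part.some (lookup e h p) := by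
  refine ⟨lookupWord e h, computable_lookupWord he hh, fun σ τ => lookupWord_mono h hle,
    fun p q => ?_⟩
  rw [Part.mem_some_iff]
  constructor
  · rintro rfl n
    exact ⟨n + 2, lookupWord_initSeg h hle p (by omega)⟩
  · intro hq
    funext n
    obtain ⟨k, hk⟩ := hq n
    have hn : n < k - 1 := by
      have := (List.getElem?_eq_some_iff.1 hk).1
      simpa [lookupWord, initSeg] using this
    rw [lookupWord_initSeg h hle p hn] at hk
    exact (Option.some.inj hk).symm

/-- Sufficient condition for Weihrauch reducibility to a problem with answers in `ℕ`, where
the answer `n` is translated to `u n`. -/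
theorem weihrauchLE_of_lookup {X Z : Type*} {δX : Representation X} {δZ : Representation Z}
    {f : MultiFun X ℕ} {g : MultiFun Z ℕ} {e : ℕ → ℕ} {h : ℕ → ℕ → ℕ} {u : ℕ → ℕ}
    (he : Computable e) (hh : Computable₂ h) (hle : ∀ t, e t ≤ t + 1) (hu : Computable u)
    (hred : ∀ p x, x ∈ δX.map p → x ∈ f.dom →
      ∃ z, z ∈ δZ.map (lookup e h p) ∧ z ∈ g.dom ∧ ∀ n ∈ g.val z, u n ∈ f.val x) :
    WeihrauchLE δX natRep f δZ natRep g := by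
  -- Position 1 of `pairing p q` is `q 0`, the answer in ℕ. Reading it at output 0 is why the bound
  -- on queries is `t + 1` and not `t`.
  refine ⟨fun p => Part.some (lookup (fun _ => 1) (fun _ a => u a) p),
    fun p => Part.some (lookup e h p),
    computableFun_lookup (Computable.const 1) (hu.comp Computable.snd) (fun t => by omega),
    computableFun_lookup he hh hle, fun G hG => ⟨_, ?_, rfl⟩⟩
  intro p x hx hxf
  obtain ⟨z, hz, hzg, hval⟩ := hred p x hx hxf
  obtain ⟨q, hq, n, hn, hnz⟩ := hG _ z hz hzg
  obtain rfl : n = q 0 := Part.mem_some_iff.1 hn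
  refine ⟨lookup (fun _ => 1) (fun _ a => u a) (pairing p q), ?_, u (q 0), ?_, hval _ hnz⟩
  · exact Part.mem_bind (Part.mem_some _) (Part.mem_bind hq (Part.mem_some _))
  · exact Part.mem_some_iff.2 rfl

theorem mem_seqRep_iff {X : Type*} {δ : Representation X} {p : Baire} {x : ℕ → X} :
    x ∈ (seqRep δ).map p ↔ ∀ i, x i ∈ δ.map fun k => p (Nat.pair i k) := by
  constructor
  · rintro ⟨hdom, rfl⟩ i
    exact ⟨hdom i, rfl⟩
  · intro hx
    exact ⟨fun i => (hx i).1, funext fun i => (hx i).2⟩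

/-! ### Comparison of rational codes -/

/-- Decides `ratNum a + 1 / (k + 1) < ratNum b`. -/
def ratTest (a k b : ℕ) : Bool :=
  decide (a.unpair.1 * (b.unpair.2.unpair.2 + 1) * (k + 1)
      + (a.unpair.2.unpair.2 + 1) * (b.unpair.2.unpair.2 + 1)
      + b.unpair.2.unpair.1 * (a.unpair.2.unpair.2 + 1) * (k + 1)
    < b.unpair.1 * (a.unpair.2.unpair.2 + 1) * (k + 1)
      + a.unpair.2.unpair.1 * (b.unpair.2.unpair.2 + 1) * (k + 1))

/-- The denominators are positive, so cross-multiplying and moving subtracted terms across leaves an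
inequality in ℕ. -/
theorem ratTest_iff (a k b : ℕ) :
    ratTest a k b = true ↔ (ratNum a : ℝ) + 1 / ((k : ℝ) + 1) < ratNum b := by
  unfold ratTest ratNum
  rw [decide_eq_true_iff]
  push_cast
  rw [div_add_div _ _ (by positivity) (by positivity), div_lt_div_iff₀ (by positivity)
    (by positivity), ← @Nat.cast_lt ℝ]
  push_cast
  constructor <;> intro h <;> linarith

theorem primrec_ratTest : Primrec fun x : ℕ × ℕ × ℕ => ratTest x.1 x.2.1 x.2.2 := by
  have h1 {f : ℕ × ℕ × ℕ → ℕ} (hf : Primrec f) : Primrec fun x => (f x).unpair.1 :=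
    Primrec.fst.comp (Primrec.unpair.comp hf)
  have h2 {f : ℕ × ℕ × ℕ → ℕ} (hf : Primrec f) : Primrec fun x => (f x).unpair.2 :=
    Primrec.snd.comp (Primrec.unpair.comp hf)
  have ha : Primrec fun x : ℕ × ℕ × ℕ => x.1 := Primrec.fst
  have hb : Primrec fun x : ℕ × ℕ × ℕ => x.2.2 := Primrec.snd.comp Primrec.snd
  have hk : Primrec fun x : ℕ × ℕ × ℕ => x.2.1 + 1 :=
    Primrec.succ.comp (Primrec.fst.comp Primrec.snd)
  have ha3 := Primrec.succ.comp (h2 (h2 ha))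
  have hb3 := Primrec.succ.comp (h2 (h2 hb))
  have mul {f g : ℕ × ℕ × ℕ → ℕ} (hf : Primrec f) (hg : Primrec g) :
      Primrec fun x => f x * g x := Primrec.nat_mul.comp hf hg
  have add {f g : ℕ × ℕ × ℕ → ℕ} (hf : Primrec f) (hg : Primrec g) :
      Primrec fun x => f x + g x := Primrec.nat_add.comp hf hg
  exact Primrec.nat_lt.decide.comp
    (add (add (mul (mul (h1 ha) hb3) hk) (mul ha3 hb3)) (mul (mul (h1 (h2 hb)) ha3) hk))
    (add (mul (mul (h1 hb) ha3) hk) (mul (mul (h1 (h2 ha)) hb3) hk))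

/-- Decides `ratNum n ≤ 0`. -/
def ratNonpos (n : ℕ) : Bool := decide (n.unpair.1 ≤ n.unpair.2.unpair.1)

theorem ratNonpos_iff (n : ℕ) : ratNonpos n = true ↔ (ratNum n : ℝ) ≤ 0 := by
  unfold ratNonpos ratNum
  rw [decide_eq_true_iff]
  push_cast
  rw [div_le_iff₀ (by positivity), zero_mul, sub_nonpos, Nat.cast_le]

theorem primrec_ratNonpos : Primrec ratNonpos :=
  Primrec.nat_le.decide.comp (Primrec.fst.comp Primrec.unpair)
    (Primrec.fst.comp (Primrec.unpair.comp (Primrec.snd.comp Primrec.unpair)))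

attribute [irreducible] ratTest ratNonpos

theorem one_half_pow_le_one_div (k : ℕ) : (1 / 2 : ℝ) ^ k ≤ 1 / ((k : ℝ) + 1) := by
  rw [div_pow, one_pow]
  apply one_div_le_one_div_of_le (by positivity)
  exact_mod_cast Nat.lt_two_pow_self (n := k)

/-! ### Semidecidability of the intersection of rational balls -/

namespace ComputableMetric

variable {X : Type*} [MetricSpace X]

/-- Semidecision, with precision `l`, of whether the `j`-th dense point lies in the ball `m`. -/
def memTest (f : ℕ × ℕ × ℕ → ℕ) (j l m : ℕ) : Bool :=
  ratTest (f (j, m.unpair.1, l)) l m.unpair.2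

theorem computable_memTest {f : ℕ × ℕ × ℕ → ℕ} (hf : Computable f) :
    Computable fun x : ℕ × ℕ × ℕ => memTest f x.1 x.2.1 x.2.2 := by
  have hm : Computable fun x : ℕ × ℕ × ℕ => x.2.2.unpair :=
    Computable.unpair.comp (Computable.snd.comp Computable.snd)
  have hl : Computable fun x : ℕ × ℕ × ℕ => x.2.1 := Computable.fst.comp Computable.snd
  have hfx : Computable fun x : ℕ × ℕ × ℕ => f (x.1, x.2.2.unpair.1, x.2.1) :=
    hf.comp (Computable.fst.pair ((Computable.fst.comp hm).pair hl))
  have hr : Computable fun x : ℕ × ℕ × ℕ => x.2.2.unpair.2 := Computable.snd.comp hm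
  have harg : Computable fun x : ℕ × ℕ × ℕ =>
      (f (x.1, x.2.2.unpair.1, x.2.1), x.2.1, x.2.2.unpair.2) := hfx.pair (hl.pair hr)
  unfold memTest
  exact primrec_ratTest.to_comp.comp harg

/-- The margin 1/(l+1) in `ratTest` absorbs the approximation error 2^{-l}. -/
theorem mem_ratBall_of_memTest {𝒳 : ComputableMetric X} {f : ℕ × ℕ × ℕ → ℕ}
    (hf : ∀ i j k : ℕ, |dist (𝒳.pt i) (𝒳.pt j) - (ratNum (f (i, j, k)) : ℝ)| ≤ (1 / 2 : ℝ) ^ k)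
    {j l m : ℕ} (h : memTest f j l m = true) : 𝒳.pt j ∈ 𝒳.ratBall m := by
  have h1 := (ratTest_iff _ _ _).1 h
  have h2 := (abs_le.1 (hf j m.unpair.1 l)).2
  have h3 := one_half_pow_le_one_div l
  rw [ratBall, Metric.mem_ball]
  linarith

/-- Holding for all large `l`, not just for one, lets two balls be tested at a common precision. -/
theorem eventually_memTest {𝒳 : ComputableMetric X} {f : ℕ × ℕ × ℕ → ℕ}
    (hf : ∀ i j k : ℕ, |dist (𝒳.pt i) (𝒳.pt j) - (ratNum (f (i, j, k)) : ℝ)| ≤ (1 / 2 : ℝ) ^ k)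
    {j m : ℕ} (h : 𝒳.pt j ∈ 𝒳.ratBall m) : ∀ᶠ l in Filter.atTop, memTest f j l m = true := by
  rw [ratBall, Metric.mem_ball] at h
  have hlim := tendsto_one_div_add_atTop_nhds_zero_nat (𝕜 := ℝ)
  -- Half the gap, since both the approximation error and the margin of the test must fit into it.
  filter_upwards [hlim.eventually_lt_const (half_pos (sub_pos.2 h))] with l hl
  rw [memTest, ratTest_iff]
  have h2 := (abs_le.1 (hf j m.unpair.1 l)).1
  have h3 := one_half_pow_le_one_div l
  linarith

attribute [irreducible] memTest

/-- The intersection is open, so if non-empty it contains a dense point. -/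
theorem exists_memTest_iff {𝒳 : ComputableMetric X} {f : ℕ × ℕ × ℕ → ℕ}
    (hf : ∀ i j k : ℕ, |dist (𝒳.pt i) (𝒳.pt j) - (ratNum (f (i, j, k)) : ℝ)| ≤ (1 / 2 : ℝ) ^ k)
    (m m' : ℕ) : (∃ j l, memTest f j l m = true ∧ memTest f j l m' = true) ↔
      (𝒳.ratBall m ∩ 𝒳.ratBall m').Nonempty := by
  constructor
  · rintro ⟨j, l, h, h'⟩
    exact ⟨𝒳.pt j, mem_ratBall_of_memTest hf h, mem_ratBall_of_memTest hf h'⟩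
  · intro h
    obtain ⟨j, hj, hj'⟩ :=
      𝒳.dense.exists_mem_open (Metric.isOpen_ball.inter Metric.isOpen_ball) h
    obtain ⟨l, hl⟩ := ((eventually_memTest hf hj).and (eventually_memTest hf hj')).exists
    exact ⟨j, l, hl⟩

theorem exists_ratBall_subset (𝒳 : ComputableMetric X) {U : Set X} (hU : IsOpen U)
    (hne : U.Nonempty) : ∃ m, 0 < (ratNum m.unpair.2 : ℝ) ∧ 𝒳.ratBall m ⊆ U := by
  obtain ⟨i, hi⟩ := 𝒳.dense.exists_mem_open hU hne
  obtain ⟨ε, hε, hsub⟩ := Metric.isOpen_iff.1 hU _ hi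
  obtain ⟨q, hq0, hq1⟩ := exists_rat_btwn hε
  obtain ⟨n, hn⟩ := exists_ratNum q
  refine ⟨Nat.pair i n, by simpa [hn] using hq0, ?_⟩
  rw [ratBall, Nat.unpair_pair, hn]
  exact (Metric.ball_subset_ball hq1.le).trans hsub

theorem iUnion_ratBall [Nonempty X] (𝒳 : ComputableMetric X) : ⋃ m, 𝒳.ratBall m = Set.univ := by
  obtain ⟨n, hn⟩ := exists_ratNum 1
  refine Set.eq_univ_of_forall fun x => ?_
  obtain ⟨i, hi⟩ := 𝒳.dense.exists_dist_lt x one_pos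
  exact Set.mem_iUnion.2 ⟨Nat.pair i n, by simpa [ratBall, hn] using hi⟩

theorem subset_negSet_iff {𝒳 : ComputableMetric X} {p : Baire} {m : ℕ} :
    𝒳.ratBall m ⊆ 𝒳.negSet p ↔ ¬ ∃ k, (𝒳.ratBall m ∩ 𝒳.ratBall (p k)).Nonempty := by
  change 𝒳.ratBall m ⊆ (⋃ i : ℕ, 𝒳.ratBall (p i))ᶜ ↔ _
  simp [Set.subset_compl_iff_disjoint_right, Set.not_nonempty_iff_eq_empty,
    Set.disjoint_iff_inter_eq_empty]

/-! ### `BCT_X ≤ C_ℕ` -/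

/-- Enumerates, shifted by one, the pairs `⟨n, m⟩` for which the ball `m` has non-positive radius
or meets the complement of the `n`-th set. The index is `⟨⟨n, k⟩, ⟨m, ⟨j, l⟩⟩⟩`, the value `a` is
the code of the `k`-th ball in the complement of the `n`-th set. -/
def badBall (f : ℕ × ℕ × ℕ → ℕ) (t a : ℕ) : ℕ :=
  bif ratNonpos t.unpair.2.unpair.1.unpair.2 ||
      (memTest f t.unpair.2.unpair.2.unpair.1 t.unpair.2.unpair.2.unpair.2 t.unpair.2.unpair.1 &&
        memTest f t.unpair.2.unpair.2.unpair.1 t.unpair.2.unpair.2.unpair.2 a)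
  then Nat.pair t.unpair.1.unpair.1 t.unpair.2.unpair.1 + 1 else 0

theorem computable_badBall {f : ℕ × ℕ × ℕ → ℕ} (hf : Computable f) :
    Computable₂ (badBall f) := by
  have h1 {g : ℕ × ℕ → ℕ} (hg : Computable g) : Computable fun x => (g x).unpair.1 :=
    Computable.fst.comp (Computable.unpair.comp hg)
  have h2 {g : ℕ × ℕ → ℕ} (hg : Computable g) : Computable fun x => (g x).unpair.2 :=
    Computable.snd.comp (Computable.unpair.comp hg)
  have ht : Computable fun x : ℕ × ℕ => x.1 := Computable.fst
  have hm := h1 (h2 ht)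
  have hj := h1 (h2 (h2 ht))
  have hl := h2 (h2 (h2 ht))
  have hmem := computable_memTest hf
  have hneg := primrec_ratNonpos.to_comp.comp (h2 hm)
  have hmeet := Primrec.and.to_comp.comp (hmem.comp (hj.pair (hl.pair hm)))
    (hmem.comp (hj.pair (hl.pair Computable.snd)))
  have hout := Computable.succ.comp (Primrec₂.natPair.to_comp.comp (h1 (h1 ht)) hm)
  exact (Computable.cond (Primrec.or.to_comp.comp hneg hmeet) hout (Computable.const 0)).of_eq
    fun _ => rfl

/-- Balls of non-positive radius must be rejected separately: they are empty, hence contained in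
every set. -/
theorem mem_range_badBall_iff {𝒳 : ComputableMetric X} {f : ℕ × ℕ × ℕ → ℕ}
    (hf : ∀ i j k : ℕ, |dist (𝒳.pt i) (𝒳.pt j) - (ratNum (f (i, j, k)) : ℝ)| ≤ (1 / 2 : ℝ) ^ k)
    (p : Baire) (n m : ℕ) :
    Nat.pair n m + 1 ∈ Set.range (lookup (fun t => t.unpair.1) (badBall f) p) ↔
      ¬ (0 < (ratNum m.unpair.2 : ℝ) ∧
        𝒳.ratBall m ⊆ 𝒳.negSet fun k => p (Nat.pair n k)) := by
  rw [not_and_or, not_lt, subset_negSet_iff, not_not, ← ratNonpos_iff]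
  simp only [← exists_memTest_iff hf]
  constructor
  · rintro ⟨t, ht⟩
    obtain ⟨a, b, rfl⟩ : ∃ a b, t = Nat.pair a b := ⟨_, _, (Nat.pair_unpair t).symm⟩
    obtain ⟨n', k, rfl⟩ : ∃ n k, a = Nat.pair n k := ⟨_, _, (Nat.pair_unpair a).symm⟩
    simp only [lookup, badBall, Nat.unpair_pair, cond_eq_ite] at ht
    split_ifs at ht with hc
    obtain ⟨rfl, rfl⟩ := Nat.pair_eq_pair.1 (Nat.succ.inj ht)
    rw [Bool.or_eq_true, Bool.and_eq_true] at hc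
    exact hc.imp id fun h => ⟨k, _, _, h⟩
  · rintro (h | ⟨k, j, l, h, h'⟩)
    · exact ⟨Nat.pair (Nat.pair n 0) (Nat.pair m 0), by simp [lookup, badBall, h]⟩
    · exact ⟨Nat.pair (Nat.pair n k) (Nat.pair m (Nat.pair j l)), by
        simp [lookup, badBall, h, h']⟩

theorem baireCategory_le_discreteChoice [Nonempty X] [CompleteSpace X]
    (𝒳 : ComputableMetric X) :
    WeihrauchLE (seqRep 𝒳.negRep) natRep (baireCategory X) natNegRep natRep discreteChoice := by
  obtain ⟨f, hfc, hf⟩ := 𝒳.computable_dist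
  refine weihrauchLE_of_lookup (e := fun t => t.unpair.1) (h := badBall f)
    (u := fun s => s.unpair.1) (Computable.fst.comp Computable.unpair) (computable_badBall hfc)
    (fun t => (Nat.unpair_left_le t).trans t.le_succ) (Computable.fst.comp Computable.unpair) ?_
  intro p A hA hdom
  have hA' : ∀ n, A n = 𝒳.negSet fun k => p (Nat.pair n k) :=
    fun n => Part.mem_some_iff.1 (mem_seqRep_iff.1 hA n)
  have key : ∀ n m, Nat.pair n m ∈
      {s : ℕ | s + 1 ∈ Set.range (lookup (fun t => t.unpair.1) (badBall f) p)}ᶜ ↔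
        0 < (ratNum m.unpair.2 : ℝ) ∧ 𝒳.ratBall m ⊆ A n := by
    intro n m
    rw [hA', ← not_iff_not, ← mem_range_badBall_iff hf, Set.mem_compl_iff, not_not]
    rfl
  refine ⟨_, Part.mem_some _, ?_, ?_⟩
  -- Baire's theorem, using completeness, puts the constructed set into the domain of discrete
  -- choice.
  · obtain ⟨n, hn⟩ := nonempty_interior_of_iUnion_of_closed (fun i => (A i).isClosed) hdom
    obtain ⟨m, hm, hsub⟩ := 𝒳.exists_ratBall_subset isOpen_interior hn
    exact ⟨Nat.pair n m, (key n m).2 ⟨hm, hsub.trans interior_subset⟩⟩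
  · intro s hs
    have hs' : Nat.pair s.unpair.1 s.unpair.2 ∈ _ := (Nat.pair_unpair s).symm ▸ hs
    obtain ⟨hm, hsub⟩ := (key _ _).1 hs'
    exact ⟨_, interior_maximal hsub Metric.isOpen_ball (Metric.mem_ball_self hm)⟩

/-! ### `C_ℕ ≤ BCT_X` -/

/-- Enumerates all balls in the complement of the `i`-th set as soon as `i` is removed, and the
empty ball with code `z` otherwise. The index is `⟨i, ⟨k, m⟩⟩`, the value `a` is the `k`-th piece of
negative information. -/
def removeBall (z t a : ℕ) : ℕ :=
  bif decide (a = t.unpair.1 + 1) then t.unpair.2.unpair.2 else z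

theorem computable_removeBall (z : ℕ) : Computable₂ (removeBall z) := by
  have ht : Primrec fun x : ℕ × ℕ => x.1.unpair := Primrec.unpair.comp Primrec.fst
  have hc : Primrec fun x : ℕ × ℕ => decide (x.2 = x.1.unpair.1 + 1) :=
    Primrec.eq.decide.comp Primrec.snd (Primrec.succ.comp (Primrec.fst.comp ht))
  exact (Primrec.cond hc
    (Primrec.snd.comp (Primrec.unpair.comp (Primrec.snd.comp ht))) (Primrec.const z)).to_comp

/-- The right side does not mention `x`: the set is all of X or empty. Once `i` is removed, all
rational balls are enumerated, and they cover X; otherwise only the empty ball is. -/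
theorem mem_negSet_removeBall_iff [Nonempty X] {𝒳 : ComputableMetric X} {z : ℕ}
    (hz : 𝒳.ratBall z = ∅) (p : Baire) (i : ℕ) (x : X) :
    x ∈ 𝒳.negSet (fun k => lookup (fun t => t.unpair.2.unpair.1) (removeBall z) p (Nat.pair i k)) ↔
      i + 1 ∉ Set.range p := by
  change x ∉ ⋃ k, 𝒳.ratBall _ ↔ _
  rw [not_iff_not, Set.mem_iUnion]
  constructor
  · rintro ⟨k, hk⟩
    simp only [lookup, removeBall, Nat.unpair_pair, cond_eq_ite, decide_eq_true_eq] at hk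
    split_ifs at hk with h
    · exact ⟨_, h⟩
    · simp [hz] at hk
  · rintro ⟨k, hk⟩
    obtain ⟨m, hm⟩ := Set.mem_iUnion.1 (𝒳.iUnion_ratBall.symm ▸ Set.mem_univ x)
    exact ⟨Nat.pair k m, by simpa [lookup, removeBall, hk] using hm⟩

theorem discreteChoice_le_baireCategory [Nonempty X] (𝒳 : ComputableMetric X) :
    WeihrauchLE natNegRep natRep discreteChoice (seqRep 𝒳.negRep) natRep (baireCategory X) := by
  obtain ⟨z, hz⟩ : ∃ z, 𝒳.ratBall z = ∅ := by
    obtain ⟨n, hn⟩ := exists_ratNum 0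
    exact ⟨Nat.pair 0 n, by simp [ratBall, hn]⟩
  have hunpair : Primrec fun t : ℕ => t.unpair.2.unpair.1 :=
    Primrec.fst.comp (Primrec.unpair.comp (Primrec.snd.comp Primrec.unpair))
  refine weihrauchLE_of_lookup (e := fun t => t.unpair.2.unpair.1) (h := removeBall z) (u := id)
    hunpair.to_comp (computable_removeBall z)
    (fun t => (Nat.unpair_left_le _).trans ((Nat.unpair_right_le t).trans t.le_succ))
    Computable.id ?_
  intro p A hA hdom
  obtain rfl := Part.mem_some_iff.1 hA
  refine ⟨_, mem_seqRep_iff.2 fun i => Part.mem_some _, ?_, ?_⟩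
  · obtain ⟨i, hi⟩ := hdom
    exact Set.eq_univ_of_forall fun x =>
      Set.mem_iUnion.2 ⟨i, (mem_negSet_removeBall_iff hz p i x).2 hi⟩
  -- A single point of the `n`-th set already shows that `n` was never removed.
  · rintro n ⟨x, hx⟩
    exact (mem_negSet_removeBall_iff hz p n x).1 (interior_subset hx)

end ComputableMetric

end CompAnalysis

theorem mainTheorem3 {X : Type*} [MetricSpace X] [Nonempty X] [CompleteSpace X]
    (𝒳 : CompAnalysis.ComputableMetric X) :
    CompAnalysis.WeihrauchEquiv
      (CompAnalysis.seqRep 𝒳.negRep) CompAnalysis.natRep (CompAnalysis.baireCategory X)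
      CompAnalysis.natNegRep CompAnalysis.natRep CompAnalysis.discreteChoice :=
  ⟨𝒳.baireCategory_le_discreteChoice, 𝒳.discreteChoice_le_baireCategory⟩
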